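/- All rings are commutative with unit. Let $R \subseteq S$ be an extension of rings, and let $[R,S]$ denote the set of rings $T$ with $R \subseteq T \subseteq S$. A ring extension $A \subseteq B$ is called: - a Prüfer extension if for each ring $T$ with $A \subseteq T \subseteq B$ the inclusion $A \subseteq T$ is a flat epimorphism (that is, $T$ is a flat $A$-module and $A \to T$ is an epimorphism of commutative rings); - incomparable if for all prime ideals $Q \subseteq Q'$ of $B$, $Q \cap A = Q' \cap A$ implies $Q = Q'$; - residually algebraic if $A/(Q \cap A) \subseteq B/Q$ is algebraic for each prime ideal $Q$ of $B$. The extension $R \subseteq S$ is called quasi-Prüfer if $\overline{R} \subseteq S$ is a Prüfer extension, where $\overline{R}$ is the integral closure of $R$ in $S$; an INC-pair if $R \subseteq T$ is incomparable for each $T \in [R,S]$; and a residually algebraic pair if $R \subseteq T$ is residually algebraic for each $T \in [R,S]$. **Theorem.** The following conditions are equivalent: 1. $R \subseteq S$ is quasi-Prüfer; 2. $R \subseteq S$ is an INC-pair; 3. $R \subseteq S$ is a residually algebraic pair. -/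

import Mathlib

/-! Ring extensions `R ⊆ S` of commutative rings are given as `R`-algebras `S` with injective
structure map; the intermediate rings `T ∈ [R, S]` are the `R`-subalgebras of `S`. -/

/-- `R → S` is a flat epimorphism: `S` is flat over `R` and `R → S` is an epimorphism of
commutative rings (in the sense of `Algebra.IsEpi`, i.e. `S ⊗[R] S → S` is injective; compare
`CommRingCat.epi_iff_epi`). -/
def IsFlatEpi (R S : Type*) [CommRing R] [CommRing S] [Algebra R S] : Prop :=
  Module.Flat R S ∧ Algebra.IsEpi R S

/-- `R ⊆ S` is a Prüfer extension: `R ⊆ T` is a flat epimorphism for every intermediate ring `T`. -/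
def IsPruferExtension (R S : Type*) [CommRing R] [CommRing S] [Algebra R S] : Prop :=
  ∀ T : Subalgebra R S, IsFlatEpi R T

/-- `R ⊆ S` is quasi-Prüfer: if `A` is the integral closure of `R` in `S`, then `A ⊆ S` is a
Prüfer extension. -/
def IsQuasiPruferExtension (R S : Type*) [CommRing R] [CommRing S] [Algebra R S] : Prop :=
  IsPruferExtension (integralClosure R S) S

/-- `R ⊆ S` is incomparable: comparable primes of `S` with the same contraction to `R` coincide. -/
def IsIncomparable (R S : Type*) [CommRing R] [CommRing S] [Algebra R S] : Prop :=
  ∀ Q Q' : Ideal S, Q.IsPrime → Q'.IsPrime → Q ≤ Q' → Q.under R = Q'.under R → Q = Q'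

/-- `R ⊆ S` is an INC-pair: `R ⊆ T` is incomparable for every intermediate ring `T`. -/
def IsINCPair (R S : Type*) [CommRing R] [CommRing S] [Algebra R S] : Prop :=
  ∀ T : Subalgebra R S, IsIncomparable R T

/-- `R ⊆ S` is residually algebraic: for every prime `Q` of `S`, the extension of domains
`R / (Q ∩ R) ⊆ S / Q` is algebraic. -/
def IsResiduallyAlgebraic (R S : Type*) [CommRing R] [CommRing S] [Algebra R S] : Prop :=
  ∀ Q : Ideal S, Q.IsPrime → Algebra.IsAlgebraic (R ⧸ Q.under R) (S ⧸ Q)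

/-- `R ⊆ S` is a residually algebraic pair: `R ⊆ T` is residually algebraic for every intermediate
ring `T`. -/
def IsResiduallyAlgebraicPair (R S : Type*) [CommRing R] [CommRing S] [Algebra R S] : Prop :=
  ∀ T : Subalgebra R S, IsResiduallyAlgebraic R T

/-!
The proof runs through the cycle quasi-Prüfer ⇒ residually algebraic pair ⇒ INC-pair ⇒ quasi-Prüfer.

*Quasi-Prüfer ⇒ residually algebraic pair.* Let `A` be the integral closure of `R` in `S`, let `T`
be an intermediate ring, and let `B` be the integral closure of `T` in `S`, so that `A ⊆ B`. An
epimorphism induces trivial residue field extensions (`isResiduallyAlgebraic_of_isEpi`), and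
`R ⊆ A` is integral, so `R ⊆ B` is residually algebraic. Since `T ⊆ B` is integral, every prime of
`T` lifts to `B`, and the property descends to `R ⊆ T`.

*Residually algebraic pair ⇒ INC-pair.* This holds for each intermediate ring separately: in a
domain algebraic over `R / p`, every nonzero ideal meets `R / p`
(`IsResiduallyAlgebraic.isIncomparable`).

*INC-pair ⇒ quasi-Prüfer.* The INC-property passes from `R ⊆ S` to `A ⊆ S`. Let `x : S` and let `m`
be a prime of `A`. If every polynomial over `A` vanishing at `x` had all its coefficients in `m`,
then the fiber of `A[x]` over `m` would be an affine line, which contains comparable primes; so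
some `f` with `f(x) = 0` has a coefficient outside `m` (`exists_coeff_notMem_of_isIncomparable`).
With `D` the conductor of `x` into `A`, a Horner-scheme argument and the integral closedness of `A`
show that all coefficients of `f` lie in `D + D x ⊆ A` (`coeff_mem_valuativeIdeal`). Hence
`D + D x = A`, say `u + v x = 1` with `u, v ∈ D`. This condition is inherited by every intermediate
ring, and it yields a flat epimorphism: flatness by the equational criterion
(`IsLocallyValuative.flat`), the epimorphism property by moving `u x` and `v x` across the tensor
sign (`IsLocallyValuative.isEpi`).
-/

/-! ### Residually algebraic extensions -/

section ResiduallyAlgebraic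

open Polynomial TensorProduct

variable {R A B : Type*} [CommRing R] [CommRing A] [CommRing B] [Algebra R A] [Algebra R B]
  [Algebra A B] [IsScalarTower R A B]

/-- Quotient-free form: modulo each prime `Q`, every element of `A` is a root of a polynomial over
`R` that is nonzero modulo `Q ∩ R`. -/
theorem isResiduallyAlgebraic_iff : IsResiduallyAlgebraic R A ↔
    ∀ Q : Ideal A, Q.IsPrime → ∀ x : A, ∃ f : R[X],
      (∃ n, f.coeff n ∉ Q.under R) ∧ aeval x f ∈ Q := by
  have key (Q : Ideal A) (x : A) (f : R[X]) :
      aeval (Ideal.Quotient.mk Q x) (f.map (Ideal.Quotient.mk (Q.under R))) =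
        Ideal.Quotient.mk Q (aeval x f) := by
    rw [aeval_def, eval₂_map, aeval_def, hom_eval₂]
    rfl
  have key' (Q : Ideal A) (f : R[X]) :
      f.map (Ideal.Quotient.mk (Q.under R)) ≠ 0 ↔ ∃ n, f.coeff n ∉ Q.under R := by
    simp [Polynomial.ext_iff, Ideal.Quotient.eq_zero_iff_mem]
  refine forall₂_congr fun Q _ ↦ ?_
  rw [Algebra.isAlgebraic_def, Ideal.Quotient.mk_surjective.forall]
  refine forall_congr' fun x ↦ ⟨?_, ?_⟩
  · rintro ⟨g, hg, hgx⟩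
    obtain ⟨f, rfl⟩ := map_surjective _ Ideal.Quotient.mk_surjective g
    exact ⟨f, (key' Q f).1 hg, by rwa [← Ideal.Quotient.eq_zero_iff_mem, ← key]⟩
  · rintro ⟨f, hf, hfx⟩
    exact ⟨_, (key' Q f).2 hf, by rwa [key, Ideal.Quotient.eq_zero_iff_mem]⟩

theorem IsResiduallyAlgebraic.isIncomparable (h : IsResiduallyAlgebraic R A) :
    IsIncomparable R A := by
  intro Q Q' hQ hQ' hle heq
  by_contra hne
  obtain ⟨x, hx', hx⟩ := SetLike.exists_of_lt (lt_of_le_of_ne hle hne)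
  obtain ⟨f, ⟨n, hn⟩, hf⟩ := isResiduallyAlgebraic_iff.1 h Q hQ x
  refine (Ideal.comap_lt_comap_of_root_mem_sdiff hle ⟨hx', hx⟩ (p := f) ?_ hf).ne heq
  intro h0
  have := congr_arg (coeff · n) h0
  simp only [coeff_map, coeff_zero] at this
  exact hn (Ideal.Quotient.eq_zero_iff_mem.1 this)

theorem isResiduallyAlgebraic_of_isIntegral [Algebra.IsIntegral R A] :
    IsResiduallyAlgebraic R A := by
  refine isResiduallyAlgebraic_iff.2 fun Q hQ x ↦ ?_
  obtain ⟨f, hf, hfx⟩ := Algebra.IsIntegral.isIntegral (R := R) x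
  refine ⟨f, ⟨f.natDegree, ?_⟩, by simp [aeval_def, hfx]⟩
  rw [coeff_natDegree, hf.leadingCoeff]
  exact (Ideal.ne_top_iff_one _).1 (hQ.under R).ne_top

/-- Variant of the definition for a prime `p` of `R` that is only propositionally equal to
`Q ∩ R`. -/
theorem IsResiduallyAlgebraic.of_liesOver (h : IsResiduallyAlgebraic R A) (Q : Ideal A)
    [hQ : Q.IsPrime] (p : Ideal R) [Q.LiesOver p] : Algebra.IsAlgebraic (R ⧸ p) (A ⧸ Q) := by
  obtain rfl := Q.over_def p
  exact h Q hQ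

theorem IsResiduallyAlgebraic.trans (h₁ : IsResiduallyAlgebraic R A)
    (h₂ : IsResiduallyAlgebraic A B) : IsResiduallyAlgebraic R B := by
  intro Q hQ
  have := h₂.of_liesOver Q (Q.under A)
  have := h₁.of_liesOver (Q.under A) (Q.under R)
  have : IsScalarTower (R ⧸ Q.under R) (A ⧸ Q.under A) (B ⧸ Q) := by
    refine .of_algebraMap_eq (Ideal.Quotient.mk_surjective.forall.2 fun r ↦ ?_)
    exact congr_arg (Ideal.Quotient.mk Q) (IsScalarTower.algebraMap_apply R A B r)
  exact Algebra.IsAlgebraic.trans (R ⧸ Q.under R) (A ⧸ Q.under A) (B ⧸ Q)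

/-- Residual algebraicity descends along an integral extension `A ⊆ B`, by lying over. -/
theorem IsResiduallyAlgebraic.of_isIntegral_tower [Algebra.IsIntegral A B] [FaithfulSMul A B]
    (h : IsResiduallyAlgebraic R B) : IsResiduallyAlgebraic R A := by
  refine isResiduallyAlgebraic_iff.2 fun Q hQ x ↦ ?_
  obtain ⟨P, -, hP, rfl⟩ := Ideal.exists_ideal_over_prime_of_isIntegral Q (⊥ : Ideal B)
    (by simp [Ideal.comap_bot_of_injective _ (FaithfulSMul.algebraMap_injective A B)])
  obtain ⟨f, hf, hfx⟩ := isResiduallyAlgebraic_iff.1 h P hP (algebraMap A B x)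
  exact ⟨f, by simpa [Ideal.under, Ideal.comap_comap, ← IsScalarTower.algebraMap_eq] using hf,
    by simpa [aeval_algebraMap_apply] using hfx⟩

/-- An epimorphism is residually algebraic; in fact `κ(Q)` is the field of fractions of the image
of `R`. -/
theorem isResiduallyAlgebraic_of_isEpi [Algebra.IsEpi R A] : IsResiduallyAlgebraic R A := by
  refine isResiduallyAlgebraic_iff.2 fun Q hQ b ↦ ?_
  let L := Q.ResidueField
  let K : Subfield L := Subfield.closure (algebraMap R L).range
  have hK (r : R) : algebraMap R L r ∈ K := Subfield.subset_closure ⟨r, rfl⟩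
  have hb : algebraMap A L b ∈ K := by
    -- otherwise a `K`-linear functional killing `1` but not `b` tells `1 ⊗ b` from `b ⊗ 1`
    by_contra hb
    obtain ⟨φ, hφ, hφ1⟩ := Submodule.exists_le_ker_of_notMem (p := K ∙ (1 : L))
      (v := algebraMap A L b) (by
        rw [Submodule.mem_span_singleton]
        rintro ⟨c, hc⟩
        exact hb (hc ▸ by simp [Subfield.smul_def]))
    have hφ1 : φ 1 = 0 := hφ1 (Submodule.mem_span_singleton_self _)
    have hφR (r : R) (x : L) : φ (r • x) = ⟨_, hK r⟩ * φ x := by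
      rw [← smul_eq_mul, ← map_smul, Algebra.smul_def]
      rfl
    let β : A →ₗ[R] A →ₗ[R] L := LinearMap.mk₂ R
      (fun x y ↦ φ (algebraMap A L x) * algebraMap A L y)
      (fun x y z ↦ by simp [add_mul])
      (fun r x y ↦ by
        rw [Algebra.smul_def r x, map_mul, ← IsScalarTower.algebraMap_apply, ← Algebra.smul_def,
          hφR, Algebra.smul_def r, Subfield.coe_mul, mul_assoc])
      (fun x y z ↦ by simp [mul_add])
      (fun r x y ↦ by
        rw [Algebra.smul_def, map_mul, ← IsScalarTower.algebraMap_apply, mul_left_comm,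
          ← Algebra.smul_def])
    have := congr_arg (TensorProduct.lift β)
      ((Algebra.isEpi_iff_forall_one_tmul_eq R A).1 ‹_› b)
    exact hφ (by simpa [β, hφ1] using this.symm)
  obtain ⟨_, hc, _, ha, h⟩ := Subfield.mem_closure_iff.1 hb
  rw [Subring.closure_eq] at hc ha
  obtain ⟨c, rfl⟩ := hc
  obtain ⟨a, rfl⟩ := ha
  have hmem (r : R) : algebraMap R L r = 0 ↔ r ∈ Q.under R := by
    rw [IsScalarTower.algebraMap_apply R A L, Ideal.algebraMap_residueField_eq_zero]
    rfl
  -- `b` equals `c / a` in `κ(Q)`; if `a` vanishes there, then so does the quotient, by `c / 0 = 0`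
  by_cases ha : algebraMap R L a = 0
  · refine ⟨X, ⟨1, by simpa using (Ideal.ne_top_iff_one _).1 (hQ.under R).ne_top⟩, ?_⟩
    rw [aeval_X, ← Ideal.algebraMap_residueField_eq_zero, ← h, ha, div_zero]
  · refine ⟨C a * X - C c, ⟨1, by simpa [coeff_C, ← hmem] using ha⟩, ?_⟩
    rw [← Ideal.algebraMap_residueField_eq_zero]
    simp only [map_sub, map_mul, aeval_X, aeval_C, ← IsScalarTower.algebraMap_apply]
    rw [sub_eq_zero, mul_comm, ← eq_div_iff ha]
    exact h.symm

end ResiduallyAlgebraic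

/-! ### A sufficient condition for Prüfer extensions -/

section Prufer

open Polynomial TensorProduct

/-- The conductor `{a | a x ∈ A}` of an element `x : S` into `A`, as an ideal of `A`; membership is
expressed by `a x` lying in the image of `A → S`. -/
def elementConductor (A : Type*) {S : Type*} [CommRing A] [CommRing S] [Algebra A S] (x : S) :
    Ideal A :=
  (⊥ : Subalgebra A S).toSubmodule.colon {x}

/-- Every `x : S` admits `u, v` in its conductor `D` into `A` with `u + v x = 1`, that is,
`D + D x` is the unit ideal of `A`. Locally on `A`, this says that `x ∈ A` or `x⁻¹ ∈ A`. -/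
def IsLocallyValuative (A S : Type*) [CommRing A] [CommRing S] [Algebra A S] : Prop :=
  ∀ x : S, ∃ u ∈ elementConductor A x, ∃ v ∈ elementConductor A x,
    algebraMap A S u + algebraMap A S v * x = 1

variable {A S : Type*} [CommRing A] [CommRing S] [Algebra A S]

theorem mem_elementConductor {x : S} {a : A} :
    a ∈ elementConductor A x ↔ ∃ b : A, algebraMap A S b = algebraMap A S a * x := by
  rw [← Algebra.smul_def]
  exact Submodule.mem_colon_singleton

namespace IsLocallyValuative

theorem subalgebra (h : IsLocallyValuative A S) (T : Subalgebra A S) : IsLocallyValuative A T := by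
  have key (x : T) (a : A) (ha : a ∈ elementConductor A (x : S)) : a ∈ elementConductor A x := by
    obtain ⟨b, hb⟩ := mem_elementConductor.1 ha
    exact mem_elementConductor.2 ⟨b, Subtype.ext hb⟩
  intro x
  obtain ⟨u, hu, v, hv, huv⟩ := h x
  exact ⟨u, key x u hu, v, key x v hv, Subtype.ext huv⟩

/-- The epimorphism property: writing `x = a + b x` with `a = u x` and `b = v x` in `A`, one has
`b ⊗ x = (v x) ⊗ x = x ⊗ (v x) = x ⊗ b`, whence `1 ⊗ x = x ⊗ 1`. -/
theorem isEpi (h : IsLocallyValuative A S) : Algebra.IsEpi A S := by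
  refine (Algebra.isEpi_iff_forall_one_tmul_eq A S).2 fun x ↦ ?_
  obtain ⟨u, hu, v, hv, huv⟩ := h x
  obtain ⟨a, ha⟩ := mem_elementConductor.1 hu
  obtain ⟨b, hb⟩ := mem_elementConductor.1 hv
  have hx : x = a • (1 : S) + b • x := by
    rw [Algebra.smul_def, Algebra.smul_def, mul_one, ha, hb, ← add_mul, huv, one_mul]
  have hbv : b • (1 : S) = v • x := by rw [Algebra.smul_def, mul_one, hb, Algebra.smul_def]
  calc (1 : S) ⊗ₜ[A] x = 1 ⊗ₜ (a • (1 : S) + b • x) := by rw [← hx]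
    _ = (a • (1 : S)) ⊗ₜ 1 + (b • (1 : S)) ⊗ₜ x := by
      rw [tmul_add, smul_tmul, smul_tmul]
    _ = (a • (1 : S)) ⊗ₜ 1 + x ⊗ₜ (b • (1 : S)) := by rw [hbv, smul_tmul v]
    _ = (a • (1 : S) + b • x) ⊗ₜ 1 := by rw [add_tmul, smul_tmul b]
    _ = x ⊗ₜ 1 := by rw [← hx]

/-- Flatness by the equational criterion. The conductor of each `x i` generates the unit ideal of
`S`, hence so does the product of the conductors; the coefficients of a representation of `1` then
trivialize every relation among the `x i`. -/
theorem flat (h : IsLocallyValuative A S) (hAS : Function.Injective (algebraMap A S)) :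
    Module.Flat A S := by
  refine .of_forall_isTrivialRelation fun {l f x} hfx ↦ ?_
  have hx (i : Fin l) : (elementConductor A (x i)).map (algebraMap A S) = ⊤ := by
    obtain ⟨u, hu, v, hv, huv⟩ := h (x i)
    rw [Ideal.eq_top_iff_one, ← huv]
    exact add_mem (Ideal.mem_map_of_mem _ hu) (Ideal.mul_mem_right _ _ (Ideal.mem_map_of_mem _ hv))
  have hprod : (∏ i, elementConductor A (x i)).map (algebraMap A S) = ⊤ := by
    rw [← Ideal.mapHom_apply, map_prod]
    exact Finset.prod_induction _ (· = ⊤) (fun _ _ h h' ↦ by simp [h, h']) Ideal.one_eq_top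
      fun i _ ↦ hx i
  -- `1 = ∑ j, s j * d j` with every `d j` in all the conductors: `x i = ∑ j, (d j * x i) * s j`
  obtain ⟨k, s, d, hd⟩ := Submodule.mem_span_set'.1 ((Ideal.eq_top_iff_one _).1 hprod)
  have hdx (j : Fin k) (i : Fin l) : ∃ a : A, algebraMap A S a = d j * x i := by
    obtain ⟨c, hc, hc'⟩ := (d j).2
    rw [← hc']
    exact mem_elementConductor.1 (Ideal.prod_le_inf.trans (Finset.inf_le (Finset.mem_univ i)) hc)
  choose a ha using hdx
  refine ⟨k, fun i j ↦ a j i, s, fun i ↦ ?_, fun j ↦ hAS ?_⟩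
  · calc x i = (∑ j, s j • (d j : S)) * x i := by rw [hd, one_mul]
      _ = ∑ j, a j i • s j := by
        rw [Finset.sum_mul]
        exact Finset.sum_congr rfl fun j _ ↦ by
          rw [Algebra.smul_def (a j i), ha, smul_eq_mul]
          ring
  · simp only [map_sum, map_mul, ha, map_zero, mul_left_comm, ← Finset.mul_sum]
    simp only [← Algebra.smul_def, hfx, mul_zero]

theorem isPruferExtension (h : IsLocallyValuative A S)
    (hAS : Function.Injective (algebraMap A S)) : IsPruferExtension A S := fun T ↦
  ⟨(h.subalgebra T).flat fun _ _ hab ↦ hAS (congr_arg Subtype.val hab), (h.subalgebra T).isEpi⟩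

end IsLocallyValuative

/-! ### Polynomial relations over an integrally closed subring -/

/-- The ideal `D + D x` of `A`, where `D` is the conductor of `x` into `A`; membership is expressed
in `S`, where the products with `x` live. -/
def valuativeIdeal (A : Type*) {S : Type*} [CommRing A] [CommRing S] [Algebra A S] (x : S) :
    Ideal A where
  carrier := {c | ∃ u ∈ elementConductor A x, ∃ v ∈ elementConductor A x,
    algebraMap A S u + algebraMap A S v * x = algebraMap A S c}
  zero_mem' := ⟨0, zero_mem _, 0, zero_mem _, by simp⟩
  add_mem' := by
    rintro c c' ⟨u, hu, v, hv, h⟩ ⟨u', hu', v', hv', h'⟩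
    refine ⟨_, add_mem hu hu', _, add_mem hv hv', ?_⟩
    rw [map_add, map_add, map_add, ← h, ← h']
    ring
  smul_mem' := by
    rintro r c ⟨u, hu, v, hv, h⟩
    refine ⟨_, Ideal.mul_mem_left _ r hu, _, Ideal.mul_mem_left _ r hv, ?_⟩
    rw [smul_eq_mul, map_mul, map_mul, map_mul, ← h]
    ring

/-- If `A` is integrally closed in `S`, all coefficients of a polynomial vanishing at `x` lie in
`D + D x`, where `D` is the conductor of `x`: the leading coefficient lies in `D`, and Horner's
scheme lowers the degree. -/
theorem coeff_mem_valuativeIdeal [IsIntegrallyClosedIn A S] {x : S} {f : A[X]}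
    (hf : aeval x f = 0) (n : ℕ) : f.coeff n ∈ valuativeIdeal A x := by
  have hAS : Function.Injective (algebraMap A S) := IsIntegralClosure.algebraMap_injective A A S
  obtain ⟨m, hm⟩ : ∃ m, f.natDegree ≤ m := ⟨_, le_rfl⟩
  induction m generalizing f n with
  | zero =>
    obtain ⟨r, rfl⟩ := natDegree_eq_zero.mp (Nat.le_zero.1 hm)
    have : r = 0 := hAS (by simpa using hf)
    simp [this]
  | succ m IH =>
    obtain hm' | hm' := hm.lt_or_eq
    · exact IH hf n (Nat.lt_succ_iff.1 hm')
    obtain ⟨a, ha⟩ := IsIntegrallyClosedIn.isIntegral_iff.1 (isIntegral_leadingCoeff_smul f x hf)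
    rw [Algebra.smul_def] at ha
    have hlc : f.leadingCoeff ∈ elementConductor A x := mem_elementConductor.2 ⟨a, ha⟩
    have hlcE : f.leadingCoeff ∈ valuativeIdeal A x := ⟨_, hlc, 0, zero_mem _, by simp⟩
    have haE : a ∈ valuativeIdeal A x := ⟨0, zero_mem _, _, hlc, by simp [ha]⟩
    -- `a = f.leadingCoeff * x` lies in `A`, so the top term of `f` is absorbed into the next one
    have hg : aeval x (f.eraseLead + C a * X ^ m) = 0 := by
      have := eraseLead_add_C_mul_X_pow f
      rw [← this, map_add, map_mul, aeval_C, aeval_X_pow, hm', pow_succ'] at hf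
      rw [map_add, map_mul, aeval_C, aeval_X_pow, ha, mul_assoc, hf]
    have hdeg : (f.eraseLead + C a * X ^ m).natDegree ≤ m :=
      natDegree_add_le_of_degree_le ((eraseLead_natDegree_le f).trans (by omega))
        (natDegree_C_mul_X_pow_le a m)
    have hn := IH hg n hdeg
    rw [coeff_add, coeff_C_mul_X_pow, eraseLead_coeff] at hn
    by_cases hnf : n = f.natDegree
    · rwa [hnf]
    · rw [if_neg hnf] at hn
      refine (Ideal.add_mem_iff_left _ ?_).1 hn
      split_ifs
      exacts [haE, zero_mem _]

/-- If `A ⊆ A[x]` is incomparable, no prime `m` of `A` contains the coefficients of all polynomials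
vanishing at `x`: otherwise `m A[X]` and `m A[X] + (X)` would descend to distinct comparable primes
of `A[x]`, both lying over `m`. -/
theorem exists_coeff_notMem_of_isIncomparable (x : S)
    (h : IsIncomparable A (Algebra.adjoin A {x})) (m : Ideal A) [hm : m.IsPrime] :
    ∃ f : A[X], aeval x f = 0 ∧ ∃ n, f.coeff n ∉ m := by
  by_contra! hcon
  let φ : A[X] →ₐ[A] Algebra.adjoin A {x} := aeval ⟨x, Algebra.self_mem_adjoin_singleton A x⟩
  have hφx (f : A[X]) : (φ f : S) = aeval x f := by
    rw [← Subalgebra.aeval_coe]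
  have hφ : Function.Surjective φ := by
    rintro ⟨y, hy⟩
    rw [Algebra.adjoin_singleton_eq_range_aeval] at hy
    obtain ⟨f, rfl⟩ := hy
    exact ⟨f, Subtype.ext (hφx f)⟩
  have hker : RingHom.ker φ ≤ m.map C := by
    intro f hf
    rw [Ideal.mem_map_C_iff]
    exact hcon f (by rw [← hφx, (RingHom.mem_ker).1 hf]; rfl)
  -- `m.comap (evalRingHom 0)` is the ideal `m A[X] + (X)`
  have hle : m.map C ≤ m.comap (evalRingHom 0) := by
    rw [Ideal.map_le_iff_le_comap]
    intro a ha
    simpa using ha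
  have hcomap {N : Ideal A[X]} (hN : RingHom.ker φ ≤ N) : (N.map φ).comap φ = N := by
    rw [Ideal.comap_map_of_surjective _ hφ]
    exact sup_eq_left.2 hN
  have hunder {N : Ideal A[X]} (hN : RingHom.ker φ ≤ N) : (N.map φ).under A = N.comap C := by
    conv_rhs => rw [← hcomap hN]
    rw [Ideal.under, ← φ.comp_algebraMap, ← Ideal.comap_comap]
    rfl
  have : (m.map (C : A →+* A[X])).IsPrime := Ideal.isPrime_map_C_of_isPrime
  have heq := h _ _ (Ideal.map_isPrime_of_surjective hφ hker)
    (Ideal.map_isPrime_of_surjective hφ (hker.trans hle)) (Ideal.map_mono hle) (by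
      rw [hunder hker, hunder (hker.trans hle)]
      ext a
      rw [Ideal.mem_comap, Ideal.mem_map_C_iff]
      refine ⟨fun h ↦ by simpa using h 0, fun h n ↦ ?_⟩
      rw [coeff_C]
      split_ifs
      exacts [by simpa using h, zero_mem _])
  have hX : (X : A[X]) ∈ m.map C := by
    rw [← hcomap hker, heq, hcomap (hker.trans hle)]
    simp
  exact (Ideal.ne_top_iff_one m).1 hm.ne_top (by simpa using Ideal.mem_map_C_iff.1 hX 1)

end Prufer

/-! ### The three classes of ring extensions -/

section Pairs

variable {R S : Type*} [CommRing R] [CommRing S] [Algebra R S]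

theorem IsResiduallyAlgebraicPair.isINCPair (h : IsResiduallyAlgebraicPair R S) :
    IsINCPair R S := fun T ↦ (h T).isIncomparable

/-- An INC-pair is locally valuative if `R` is integrally closed in `S`: no maximal ideal of `R`
contains `D + D x`, which holds the coefficients of all polynomials vanishing at `x`. -/
theorem IsINCPair.isLocallyValuative [IsIntegrallyClosedIn R S] (h : IsINCPair R S) :
    IsLocallyValuative R S := by
  intro x
  suffices hx : valuativeIdeal R x = ⊤ by
    obtain ⟨u, hu, v, hv, huv⟩ := (Ideal.eq_top_iff_one _).1 hx
    exact ⟨u, hu, v, hv, by rw [huv, map_one]⟩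
  by_contra hx
  obtain ⟨m, hm, hle⟩ := Ideal.exists_le_maximal _ hx
  obtain ⟨f, hf, n, hn⟩ := exists_coeff_notMem_of_isIncomparable x (h _) m
  exact hn (hle (coeff_mem_valuativeIdeal hf n))

theorem IsINCPair.tower_top (A : Type*) [CommRing A] [Algebra R A] [Algebra A S]
    [IsScalarTower R A S] (h : IsINCPair R S) : IsINCPair A S := by
  intro T Q Q' hQ hQ' hle heq
  refine h (T.restrictScalars R) Q Q' hQ hQ' hle ?_
  have := congr_arg (Ideal.under R) heq
  rwa [Ideal.under_under, Ideal.under_under] at this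

theorem IsINCPair.isQuasiPruferExtension (h : IsINCPair R S) :
    IsQuasiPruferExtension R S :=
  (h.tower_top (integralClosure R S)).isLocallyValuative.isPruferExtension
    Subtype.val_injective

theorem IsQuasiPruferExtension.isResiduallyAlgebraicPair (h : IsQuasiPruferExtension R S) :
    IsResiduallyAlgebraicPair R S := by
  intro T
  -- the integral closure of `T` in `S`, as an algebra over the integral closure of `R`
  let B : Subalgebra (integralClosure R S) S :=
    { (integralClosure T S).toSubsemiring with
      algebraMap_mem' := fun a ↦ (a.2 : IsIntegral R (a : S)).tower_top }
  let : Algebra T B := ((algebraMap T S).codRestrict B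
    fun t ↦ (isIntegral_algebraMap : IsIntegral T (algebraMap T S t))).toAlgebra
  have : IsScalarTower T B S := .of_algebraMap_eq fun _ ↦ rfl
  have : IsScalarTower R T B := .of_algebraMap_eq fun _ ↦ rfl
  have : FaithfulSMul T B := (faithfulSMul_iff_algebraMap_injective T B).2
    fun _ _ hab ↦ Subtype.ext (congr_arg (fun b : B ↦ (b : S)) hab)
  have : Algebra.IsIntegral T B := ⟨fun b ↦
    (isIntegral_algebraMap_iff (B := S) Subtype.val_injective).1 b.2⟩
  have := (h B).2
  exact (isResiduallyAlgebraic_of_isIntegral.trans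
    (isResiduallyAlgebraic_of_isEpi (R := integralClosure R S) (A := B))).of_isIntegral_tower

end Pairs

theorem theorem2p3 {R S : Type*} [CommRing R] [CommRing S] [Algebra R S]
    (hRS : Function.Injective (algebraMap R S)) :
    (IsQuasiPruferExtension R S ↔ IsINCPair R S) ∧
      (IsQuasiPruferExtension R S ↔ IsResiduallyAlgebraicPair R S) :=
  ⟨⟨fun h ↦ h.isResiduallyAlgebraicPair.isINCPair, fun h ↦ h.isQuasiPruferExtension⟩,
    ⟨fun h ↦ h.isResiduallyAlgebraicPair, fun h ↦ h.isINCPair.isQuasiPruferExtension⟩⟩
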